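/- Let $\mathcal C$ be a Barr-exact category: it has finite limits, every kernel pair has a coequalizer, regular epimorphisms are stable under pullback, and every internal equivalence relation is the kernel pair of some morphism. For an internal groupoid $\mathbb H$ in $\mathcal C$ write $H_0$, $H_1$ for its objects of objects and of arrows and $d,c\colon H_1\to H_0$ for its domain and codomain morphisms. Let $F=(f_0,f_1)\colon\mathbb H\to\mathbb G$ be an internal functor between internal groupoids in $\mathcal C$. - A functor $K=(k_0,k_1)\colon\mathbb A\to\mathbb B$ of internal groupoids is a *discrete fibration* if the square $c\,k_1=k_0\,c$ is a pullback. - $F$ is *final* if it is left orthogonal to all discrete fibrations of internal groupoids in $\mathcal C$: for every discrete fibration $K\colon\mathbb A\to\mathbb B$ and all functors $U\colon\mathbb H\to\mathbb A$, $V\colon\mathbb G\to\mathbb B$ with $KU=VF$ there is a unique functor $L\colon\mathbb G\to\mathbb A$ with $LF=U$ and $KL=V$. - $F$ is *full* if the morphism $\phi_F\colon H_1\to P$ induced by $(d,c)\colon H_1\to H_0\times H_0$ and $f_1\colon H_1\to G_1$ is a regular epimorphism, where $P$ is the pullback of $(d,c)\colon G_1\to G_0\times G_0$ along $f_0\times f_0\colon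 H_0\times H_0\to G_0\times G_0$. - $F$ is *essentially surjective* if the composite $c\,\overline{f_0}\colon H_0\times_{(f_0,d)}G_1\to G_0$ is a regular epimorphism, where $\overline{f_0}\colon H_0\times_{(f_0,d)}G_1\to G_1$ is the second projection of the pullback of $d\colon G_1\to G_0$ along $f_0$. Then $F$ is final if and only if it is full and essentially surjective. -/

import Mathlib

open CategoryTheory CategoryTheory.Limits

universe v u

/-- A Barr-exact category: a regular category in which every internal equivalence relation is
effective, i.e. is the kernel pair of some morphism. -/
class BarrExact (C : Type u) [Category.{v} C] : Prop extends Regular C where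
  exists_isKernelPair {R X : C} (p₁ p₂ : R ⟶ X) [IsEquivalenceRelation p₁ p₂] :
    ∃ (Q : C) (q : X ⟶ Q), IsKernelPair q p₁ p₂

/-- An internal groupoid in a category with finite limits. The composition `m` is defined on the
object `obj₁ ×_{(c, d)} obj₁` of composable pairs `(f, g)`, `cod f = dom g`, and is written in
diagrammatic order. Associativity is stated on generalized elements. -/
structure InternalGroupoid (C : Type u) [Category.{v} C] [HasFiniteLimits C] where
  /-- the object of objects -/
  obj₀ : C
  /-- the object of arrows -/
  obj₁ : C
  /-- domain -/
  d : obj₁ ⟶ obj₀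
  /-- codomain -/
  c : obj₁ ⟶ obj₀
  /-- identities -/
  e : obj₀ ⟶ obj₁
  /-- composition -/
  m : pullback c d ⟶ obj₁
  /-- inversion -/
  i : obj₁ ⟶ obj₁
  e_d : e ≫ d = 𝟙 obj₀
  e_c : e ≫ c = 𝟙 obj₀
  m_d : m ≫ d = pullback.fst c d ≫ d
  m_c : m ≫ c = pullback.snd c d ≫ c
  id_m : pullback.lift (d ≫ e) (𝟙 obj₁) (by simp [e_c]) ≫ m = 𝟙 obj₁
  m_id : pullback.lift (𝟙 obj₁) (c ≫ e) (by simp [e_d]) ≫ m = 𝟙 obj₁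
  assoc {T : C} (f g h : T ⟶ obj₁) (hfg : f ≫ c = g ≫ d) (hgh : g ≫ c = h ≫ d) :
    pullback.lift (pullback.lift f g hfg ≫ m) h (by
      rw [Category.assoc, m_c, pullback.lift_snd_assoc, hgh]) ≫ m =
      pullback.lift f (pullback.lift g h hgh ≫ m) (by
        rw [Category.assoc, m_d, pullback.lift_fst_assoc, hfg]) ≫ m
  i_d : i ≫ d = c
  i_c : i ≫ c = d
  m_i : pullback.lift (𝟙 obj₁) i (by simp [i_d]) ≫ m = d ≫ e
  i_m : pullback.lift i (𝟙 obj₁) (by simp [i_c]) ≫ m = c ≫ e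

namespace InternalGroupoid

variable {C : Type u} [Category.{v} C] [HasFiniteLimits C]

/-- An internal functor between internal groupoids. -/
@[ext]
structure Hom (H G : InternalGroupoid C) where
  /-- the component on objects -/
  f₀ : H.obj₀ ⟶ G.obj₀
  /-- the component on arrows -/
  f₁ : H.obj₁ ⟶ G.obj₁
  w_d : f₁ ≫ G.d = H.d ≫ f₀
  w_c : f₁ ≫ G.c = H.c ≫ f₀
  w_e : H.e ≫ f₁ = f₀ ≫ G.e
  w_m : H.m ≫ f₁ =
    pullback.map H.c H.d G.c G.d f₁ f₁ f₀ w_c.symm w_d.symm ≫ G.m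

/-- The identity internal functor. -/
def Hom.id (H : InternalGroupoid C) : Hom H H where
  f₀ := 𝟙 _
  f₁ := 𝟙 _
  w_d := by simp
  w_c := by simp
  w_e := by simp
  w_m := by simp

/-- Composition of internal functors. -/
def Hom.comp {H G K : InternalGroupoid C} (F : Hom H G) (F' : Hom G K) : Hom H K where
  f₀ := F.f₀ ≫ F'.f₀
  f₁ := F.f₁ ≫ F'.f₁
  w_d := by rw [Category.assoc, F'.w_d, ← Category.assoc, F.w_d, Category.assoc]
  w_c := by rw [Category.assoc, F'.w_c, ← Category.assoc, F.w_c, Category.assoc]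
  w_e := by rw [← Category.assoc, F.w_e, Category.assoc, F'.w_e, Category.assoc]
  w_m := by
    rw [← Category.assoc, F.w_m, Category.assoc, F'.w_m, ← Category.assoc, pullback.map_comp]

/-- The category of internal groupoids and internal functors. -/
instance : Category (InternalGroupoid C) where
  Hom := Hom
  id := Hom.id
  comp F F' := Hom.comp F F'
  id_comp F := Hom.ext (Category.id_comp F.f₀) (Category.id_comp F.f₁)
  comp_id F := Hom.ext (Category.comp_id F.f₀) (Category.comp_id F.f₁)
  assoc F F' F'' := Hom.ext (Category.assoc F.f₀ F'.f₀ F''.f₀) (Category.assoc F.f₁ F'.f₁ F''.f₁)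

@[simp]
theorem id_f₀ (H : InternalGroupoid C) : Hom.f₀ (𝟙 H) = 𝟙 H.obj₀ := rfl

@[simp]
theorem id_f₁ (H : InternalGroupoid C) : Hom.f₁ (𝟙 H) = 𝟙 H.obj₁ := rfl

@[simp]
theorem comp_f₀ {H G K : InternalGroupoid C} (F : H ⟶ G) (F' : G ⟶ K) :
    Hom.f₀ (F ≫ F') = F.f₀ ≫ F'.f₀ := rfl

@[simp]
theorem comp_f₁ {H G K : InternalGroupoid C} (F : H ⟶ G) (F' : G ⟶ K) :
    Hom.f₁ (F ≫ F') = F.f₁ ≫ F'.f₁ := rfl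

variable {H G : InternalGroupoid C}

/-- `F` is a discrete fibration if the square formed by `F` and the codomain morphisms is a
pullback. -/
def IsDiscreteFibration (F : H ⟶ G) : Prop :=
  IsPullback F.f₁ H.c G.c F.f₀

/-- `F` is final if it is left orthogonal to all discrete fibrations: every commutative square
from `F` to a discrete fibration has a unique diagonal filler. -/
def IsFinal (F : H ⟶ G) : Prop :=
  ∀ ⦃A B : InternalGroupoid C⦄ (K : A ⟶ B), IsDiscreteFibration K →
    ∀ (a : H ⟶ A) (b : G ⟶ B), a ≫ K = F ≫ b →
      ∃! l : G ⟶ A, F ≫ l = a ∧ l ≫ K = b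

/-- The comparison `φ_F : H₁ ⟶ P` to the joint pullback `P` of
`(d, c) : G₁ ⟶ G₀ ⨯ G₀` along `f₀ ⨯ f₀ : H₀ ⨯ H₀ ⟶ G₀ ⨯ G₀`. -/
noncomputable def phi (F : H ⟶ G) :
    H.obj₁ ⟶ pullback (prod.map F.f₀ F.f₀) (prod.lift G.d G.c) :=
  pullback.lift (prod.lift H.d H.c) F.f₁ (by
    ext <;> simp [F.w_d, F.w_c])

/-- `F` is full if `φ_F` is a regular epimorphism. -/
def IsFull (F : H ⟶ G) : Prop :=
  IsRegularEpi (phi F)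

/-- `F` is essentially surjective if the composite of the second projection
`H₀ ×_{(f₀, d)} G₁ ⟶ G₁` with `c : G₁ ⟶ G₀` is a regular epimorphism. -/
def IsEssSurj (F : H ⟶ G) : Prop :=
  IsRegularEpi (pullback.snd F.f₀ G.d ≫ G.c)

end InternalGroupoid

/-! The proof runs through the comprehensive factorization of `F`. Let `X = H₀ ×_{(f₀, d)} G₁` be
the object of arrows `F h ⟶ g`. The groupoid `H` acts on `X` by precomposition. Exactness provides
its orbit quotient `Q` (`exists_isComponents`, `exists_isCommaQuotient`). Postcomposition with
inverses descends to an action of `G` on `Q`, whose groupoid of elements is a discrete fibration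
over `G` through which `F` factors by `h ↦ [1_{F h}]` (`exists_comprehension`,
`exists_comprehension_unit`).

If `F` is final, lifting the identity of `G` yields an equivariant section `l` of `Q ⟶ G₀`. Then `X
⟶ Q ⟶ G₀` is a regular epimorphism followed by a split one, which is essential surjectivity. For `f
: F x ⟶ F y`, equivariance gives `[1_{F x}] = f • [1_{F y}] = [f⁻¹]`; by the description of orbits,
locally `1 = F k · f⁻¹` for some `k : x ⟶ y`, which is fullness.

Conversely, given a square from `F` to a discrete fibration, send `g : F h ⟶ x` to the domain of the
lift of `b g⁻¹` with codomain `a h`. Fullness makes this depend on `x` alone, and essential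
surjectivity lets it descend to `G₀`. This half needs only regularity.

Arguments use generalized elements, and "locally" means after precomposition with a regular
epimorphism. -/

section RegularCategory

variable {C : Type u} [Category.{v} C]

/-- Membership in a subobject may be checked on a regular cover. -/
theorem CategoryTheory.IsRegularEpi.exists_factor_of_mono {T' T R Y : C} {t : T' ⟶ T}
    [IsRegularEpi t] {m : R ⟶ Y} [Mono m] {y : T ⟶ Y} {z : T' ⟶ R} (h : z ≫ m = t ≫ y) :
    ∃ w : T ⟶ R, w ≫ m = y :=
  let sq : CommSq z t m y := ⟨h⟩
  ⟨sq.lift, sq.fac_right⟩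

/-- Generalized elements lift along a regular epimorphism after passing to a regular cover. -/
theorem CategoryTheory.IsRegularEpi.exists_cover [Regular C] {S R T : C} (e : S ⟶ R)
    [IsRegularEpi e] (x : T ⟶ R) :
    ∃ (T' : C) (t : T' ⟶ T) (s : T' ⟶ S), IsRegularEpi t ∧ s ≫ e = t ≫ x :=
  ⟨_, pullback.snd e x, pullback.fst e x, inferInstance, pullback.condition⟩

theorem CategoryTheory.IsRegularEpi.comp [Regular C] {X Y Z : C} (f : X ⟶ Y) (g : Y ⟶ Z)
    [IsRegularEpi f] [IsRegularEpi g] : IsRegularEpi (f ≫ g) :=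
  have := strongEpi_comp f g
  inferInstance

theorem CategoryTheory.IsRegularEpi.of_comp [Regular C] {X Y Z : C} (f : X ⟶ Y) (g : Y ⟶ Z)
    [IsRegularEpi (f ≫ g)] : IsRegularEpi g :=
  have := strongEpi_of_strongEpi f g
  inferInstance

/-- A regular epimorphism is the coequalizer of its kernel pair, and that pair is the universal
instance of `x, y`. -/
theorem CategoryTheory.IsRegularEpi.exists_desc [HasFiniteLimits C] {P Q W : C} (q : P ⟶ Q)
    [IsRegularEpi q] (f : P ⟶ W)
    (h : ∀ ⦃T : C⦄ (x y : T ⟶ P), x ≫ q = y ≫ q → x ≫ f = y ≫ f) : ∃ g : Q ⟶ W, q ≫ g = f :=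
  IsRegularEpi.exists_of_isKernelPair q (IsKernelPair.of_hasPullback q) f
    (h _ _ pullback.condition)

end RegularCategory

namespace InternalGroupoid

attribute [local simp] pullback.lift_fst pullback.lift_snd pullback.lift_fst_assoc
  pullback.lift_snd_assoc prod.lift_fst prod.lift_snd

attribute [simp] e_d e_c i_d i_c

/-! ### Calculus of generalized arrows in an internal groupoid -/

section Elements

variable {C : Type u} [Category.{v} C] [HasFiniteLimits C]

/-- Composition of generalized arrows of an internal groupoid, in diagrammatic order. -/
noncomputable def mul (G : InternalGroupoid C) {T : C} (f g : T ⟶ G.obj₁)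
    (h : f ≫ G.c = g ≫ G.d) : T ⟶ G.obj₁ :=
  pullback.lift f g h ≫ G.m

variable (G : InternalGroupoid C) {T : C}

theorem mul_congr {f f' g g' : T ⟶ G.obj₁} {h : f ≫ G.c = g ≫ G.d} {h' : f' ≫ G.c = g' ≫ G.d}
    (hf : f = f') (hg : g = g') : G.mul f g h = G.mul f' g' h' := by
  subst hf hg; rfl

@[simp]
theorem mul_d (f g : T ⟶ G.obj₁) (h : f ≫ G.c = g ≫ G.d) : G.mul f g h ≫ G.d = f ≫ G.d := by
  simp [mul, G.m_d]

@[simp]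
theorem mul_c (f g : T ⟶ G.obj₁) (h : f ≫ G.c = g ≫ G.d) : G.mul f g h ≫ G.c = g ≫ G.c := by
  simp [mul, G.m_c]

@[simp]
theorem e_d_assoc {Z : C} (k : G.obj₀ ⟶ Z) : G.e ≫ G.d ≫ k = k := by
  rw [← Category.assoc, G.e_d, Category.id_comp]

@[simp]
theorem e_c_assoc {Z : C} (k : G.obj₀ ⟶ Z) : G.e ≫ G.c ≫ k = k := by
  rw [← Category.assoc, G.e_c, Category.id_comp]

@[simp]
theorem i_d_assoc {Z : C} (k : G.obj₀ ⟶ Z) : G.i ≫ G.d ≫ k = G.c ≫ k := by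
  rw [← Category.assoc, G.i_d]

@[simp]
theorem i_c_assoc {Z : C} (k : G.obj₀ ⟶ Z) : G.i ≫ G.c ≫ k = G.d ≫ k := by
  rw [← Category.assoc, G.i_c]

theorem comp_mul {T' : C} (t : T' ⟶ T) (f g : T ⟶ G.obj₁) (h : f ≫ G.c = g ≫ G.d) :
    t ≫ G.mul f g h = G.mul (t ≫ f) (t ≫ g) (by simp [h]) := by
  rw [mul, mul, ← Category.assoc]
  congr 1
  ext <;> simp

theorem mul_mul (f g k : T ⟶ G.obj₁) (hfg : f ≫ G.c = g ≫ G.d) (hgk : g ≫ G.c = k ≫ G.d) :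
    G.mul (G.mul f g hfg) k (by simp [hgk]) = G.mul f (G.mul g k hgk) (by simp [hfg]) :=
  G.assoc f g k hfg hgk

theorem one_mul (x : T ⟶ G.obj₀) (f : T ⟶ G.obj₁) (h : (x ≫ G.e) ≫ G.c = f ≫ G.d) :
    G.mul (x ≫ G.e) f h = f := by
  have hx : x = f ≫ G.d := by simpa using h
  calc G.mul (x ≫ G.e) f h = f ≫ G.mul (G.d ≫ G.e) (𝟙 _) (by simp) := by
        rw [comp_mul]; exact G.mul_congr (by simp [hx]) (by simp)
    _ = f := by rw [mul, G.id_m, Category.comp_id]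

theorem mul_one (x : T ⟶ G.obj₀) (f : T ⟶ G.obj₁) (h : f ≫ G.c = (x ≫ G.e) ≫ G.d) :
    G.mul f (x ≫ G.e) h = f := by
  have hx : x = f ≫ G.c := by simpa using h.symm
  calc G.mul f (x ≫ G.e) h = f ≫ G.mul (𝟙 _) (G.c ≫ G.e) (by simp) := by
        rw [comp_mul]; exact G.mul_congr (by simp) (by simp [hx])
    _ = f := by rw [mul, G.m_id, Category.comp_id]

theorem mul_inv (f : T ⟶ G.obj₁) (h : f ≫ G.c = (f ≫ G.i) ≫ G.d) :
    G.mul f (f ≫ G.i) h = (f ≫ G.d) ≫ G.e := by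
  calc G.mul f (f ≫ G.i) h = f ≫ G.mul (𝟙 _) G.i (by simp) := by
        rw [comp_mul]; exact G.mul_congr (by simp) rfl
    _ = (f ≫ G.d) ≫ G.e := by rw [mul, G.m_i, Category.assoc]

theorem inv_mul (f : T ⟶ G.obj₁) (h : (f ≫ G.i) ≫ G.c = f ≫ G.d) :
    G.mul (f ≫ G.i) f h = (f ≫ G.c) ≫ G.e := by
  calc G.mul (f ≫ G.i) f h = f ≫ G.mul G.i (𝟙 _) (by simp) := by
        rw [comp_mul]; exact G.mul_congr rfl (by simp)
    _ = (f ≫ G.c) ≫ G.e := by rw [mul, G.i_m, Category.assoc]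

theorem mul_inv_cancel_left (f g : T ⟶ G.obj₁) (h : (f ≫ G.i) ≫ G.c = g ≫ G.d) :
    G.mul f (G.mul (f ≫ G.i) g h) (by simp) = g := by
  rw [← G.mul_mul f (f ≫ G.i) g (by simp) h]
  exact (G.mul_congr (h' := by simpa using h) (G.mul_inv f _) rfl).trans (G.one_mul _ _ _)

theorem inv_mul_cancel_left (f g : T ⟶ G.obj₁) (h : f ≫ G.c = g ≫ G.d) :
    G.mul (f ≫ G.i) (G.mul f g h) (by simp) = g := by
  rw [← G.mul_mul (f ≫ G.i) f g (by simp) h]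
  exact (G.mul_congr (h' := by simpa using h) (G.inv_mul f _) rfl).trans (G.one_mul _ _ _)

/-- The inverse is determined by `f g = 1`. -/
theorem eq_inv_of_mul_eq_one (f g : T ⟶ G.obj₁) (h : f ≫ G.c = g ≫ G.d)
    (hfg : G.mul f g h = (f ≫ G.d) ≫ G.e) : g = f ≫ G.i := by
  rw [← G.inv_mul_cancel_left f g h]
  exact (G.mul_congr (h' := by simp) rfl hfg).trans (G.mul_one _ _ _)

theorem eq_of_mul_inv_eq_one (f g : T ⟶ G.obj₁) (h : f ≫ G.c = (g ≫ G.i) ≫ G.d)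
    (hfg : G.mul f (g ≫ G.i) h = (f ≫ G.d) ≫ G.e) : f = g := by
  have hd : g ≫ G.d = f ≫ G.d := by simpa using congr($hfg ≫ G.c)
  calc f = G.mul f ((g ≫ G.c) ≫ G.e) (by simpa using h) := (G.mul_one _ _ _).symm
    _ = G.mul f (G.mul (g ≫ G.i) g (by simp)) (by simpa using h) :=
      G.mul_congr rfl (G.inv_mul _ _).symm
    _ = G.mul (G.mul f (g ≫ G.i) h) g (by simp) := (G.mul_mul _ _ _ _ _).symm
    _ = G.mul ((f ≫ G.d) ≫ G.e) g (by simp [hd]) := G.mul_congr hfg rfl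
    _ = g := G.one_mul _ _ _

theorem one_inv (x : T ⟶ G.obj₀) : (x ≫ G.e) ≫ G.i = x ≫ G.e :=
  (G.eq_inv_of_mul_eq_one _ _ (by simp) (by rw [one_mul]; simp)).symm

theorem mul_inv_rev (f g : T ⟶ G.obj₁) (h : f ≫ G.c = g ≫ G.d) :
    G.mul f g h ≫ G.i = G.mul (g ≫ G.i) (f ≫ G.i) (by simp [h]) := by
  refine (G.eq_inv_of_mul_eq_one _ _ (by simp) ?_).symm
  rw [G.mul_mul f g _ h (by simp), G.mul_d f g]
  exact (G.mul_congr (h' := by simp) rfl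
    (G.mul_inv_cancel_left g (f ≫ G.i) (by simp [h]))).trans (G.mul_inv f _)

variable {G} {H : InternalGroupoid C} (F : H ⟶ G)

theorem map_d : F.f₁ ≫ G.d = H.d ≫ F.f₀ := F.w_d

theorem map_c : F.f₁ ≫ G.c = H.c ≫ F.f₀ := F.w_c

theorem map_one (x : T ⟶ H.obj₀) : (x ≫ H.e) ≫ F.f₁ = (x ≫ F.f₀) ≫ G.e := by
  rw [Category.assoc, F.w_e, Category.assoc]

theorem map_mul (f g : T ⟶ H.obj₁) (h : f ≫ H.c = g ≫ H.d) :
    H.mul f g h ≫ F.f₁ = G.mul (f ≫ F.f₁) (g ≫ F.f₁) (by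
      rw [Category.assoc, F.w_c, Category.assoc, F.w_d, ← Category.assoc, h, Category.assoc]) := by
  rw [mul, mul, Category.assoc, F.w_m, ← Category.assoc]
  congr 1
  ext <;> simp

end Elements

/-! ### Groupoid actions and their discrete fibrations -/

section Action

variable {C : Type u} [Category.{v} C] [HasFiniteLimits C]

/-- A contravariant action of an internal groupoid: an arrow `f : x ⟶ y` sends the fibre over `y`
to the fibre over `x`. -/
structure Action (G : InternalGroupoid C) where
  /-- the object acted on -/
  X : C
  /-- the anchor -/
  p : X ⟶ G.obj₀
  /-- the action morphism -/
  act : pullback G.c p ⟶ X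
  act_p : act ≫ p = pullback.fst G.c p ≫ G.d
  one_act : pullback.lift (p ≫ G.e) (𝟙 X) (by simp) ≫ act = 𝟙 X
  mul_act {T : C} (f g : T ⟶ G.obj₁) (x : T ⟶ X) (hfg : f ≫ G.c = g ≫ G.d)
    (hgx : g ≫ G.c = x ≫ p) :
    pullback.lift (G.mul f g hfg) x (by simp [hgx]) ≫ act =
      pullback.lift f (pullback.lift g x hgx ≫ act) (by simp [act_p, hfg]) ≫ act

namespace Action

variable {G : InternalGroupoid C} (α : Action G) {T : C}

/-- The action of a generalized arrow on a generalized element. -/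
noncomputable def smul (f : T ⟶ G.obj₁) (x : T ⟶ α.X) (h : f ≫ G.c = x ≫ α.p) : T ⟶ α.X :=
  pullback.lift f x h ≫ α.act

theorem smul_congr {f f' : T ⟶ G.obj₁} {x x' : T ⟶ α.X} {h : f ≫ G.c = x ≫ α.p}
    {h' : f' ≫ G.c = x' ≫ α.p} (hf : f = f') (hx : x = x') : α.smul f x h = α.smul f' x' h' := by
  subst hf hx; rfl

@[simp]
theorem smul_p (f : T ⟶ G.obj₁) (x : T ⟶ α.X) (h : f ≫ G.c = x ≫ α.p) :
    α.smul f x h ≫ α.p = f ≫ G.d := by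
  simp [smul, α.act_p]

theorem comp_smul {T' : C} (t : T' ⟶ T) (f : T ⟶ G.obj₁) (x : T ⟶ α.X) (h : f ≫ G.c = x ≫ α.p) :
    t ≫ α.smul f x h = α.smul (t ≫ f) (t ≫ x) (by simp [h]) := by
  rw [smul, smul, ← Category.assoc]
  congr 1
  ext <;> simp

theorem one_smul (y : T ⟶ G.obj₀) (x : T ⟶ α.X) (h : (y ≫ G.e) ≫ G.c = x ≫ α.p) :
    α.smul (y ≫ G.e) x h = x := by
  have hy : y = x ≫ α.p := by simpa using h
  calc α.smul (y ≫ G.e) x h = x ≫ α.smul (α.p ≫ G.e) (𝟙 _) (by simp) := by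
        rw [comp_smul]; exact α.smul_congr (by simp [hy]) (by simp)
    _ = x := by rw [smul, α.one_act, Category.comp_id]

theorem mul_smul (f g : T ⟶ G.obj₁) (x : T ⟶ α.X) (hfg : f ≫ G.c = g ≫ G.d)
    (hgx : g ≫ G.c = x ≫ α.p) :
    α.smul (G.mul f g hfg) x (by simp [hgx]) = α.smul f (α.smul g x hgx) (by simp [hfg]) :=
  α.mul_act f g x hfg hgx

theorem act_eq_smul : α.act = α.smul (pullback.fst G.c α.p) (pullback.snd G.c α.p)
    pullback.condition := by
  rw [smul]
  have : pullback.lift (pullback.fst G.c α.p) (pullback.snd G.c α.p) pullback.condition = 𝟙 _ := by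
    ext <;> simp
  rw [this, Category.id_comp]

theorem comp_act (t : T ⟶ pullback G.c α.p) : t ≫ α.act =
    α.smul (t ≫ pullback.fst _ _) (t ≫ pullback.snd _ _) (by simp [pullback.condition]) := by
  rw [act_eq_smul, comp_smul]

/-- The composition of the groupoid of elements of an action. -/
noncomputable def elementsMul :
    pullback (pullback.snd G.c α.p) α.act ⟶ pullback G.c α.p :=
  pullback.lift
    (G.mul (pullback.fst _ _ ≫ pullback.fst _ _) (pullback.snd _ _ ≫ pullback.fst _ _) (by
      rw [Category.assoc, Category.assoc, pullback.condition, ← α.act_p,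
        pullback.condition_assoc]))
    (pullback.snd _ _ ≫ pullback.snd _ _) (by simp [pullback.condition])

theorem lift_elementsMul_fst (s t : T ⟶ pullback G.c α.p) (h : s ≫ pullback.snd _ _ = t ≫ α.act) :
    (pullback.lift s t h ≫ α.elementsMul) ≫ pullback.fst _ _ =
      G.mul (s ≫ pullback.fst _ _) (t ≫ pullback.fst _ _) (by
        rw [Category.assoc, Category.assoc, pullback.condition, ← α.act_p, reassoc_of% h]) := by
  rw [Category.assoc, elementsMul, pullback.lift_fst, comp_mul]
  exact G.mul_congr (by simp) (by simp)

theorem lift_elementsMul_snd (s t : T ⟶ pullback G.c α.p) (h : s ≫ pullback.snd _ _ = t ≫ α.act) :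
    (pullback.lift s t h ≫ α.elementsMul) ≫ pullback.snd _ _ = t ≫ pullback.snd _ _ := by
  simp [elementsMul]

/-- The groupoid of elements of an action: objects are the points of `X`, and an arrow `x ⟶ y` is
an arrow `f` of `G` with `x = f • y`. -/
noncomputable def elements : InternalGroupoid C where
  obj₀ := α.X
  obj₁ := pullback G.c α.p
  d := α.act
  c := pullback.snd _ _
  e := pullback.lift (α.p ≫ G.e) (𝟙 _) (by simp)
  m := α.elementsMul
  i := pullback.lift (pullback.fst _ _ ≫ G.i) α.act (by simp [α.act_p])
  e_d := α.one_act
  e_c := by simp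
  m_d := by
    rw [comp_act, comp_act]
    have h := (pullback.condition (f := pullback.snd G.c α.p) (g := α.act))
    rw [comp_act] at h
    refine Eq.trans (α.smul_congr (h' := ?_) (pullback.lift_fst _ _ _) (pullback.lift_snd _ _ _)) ?_
    · simp [pullback.condition]
    -- Domains are computed by the action, so this law is `(f g) • x = f • (g • x)`.
    rw [α.mul_smul _ _ _ _ (by simp [pullback.condition])]
    exact α.smul_congr rfl h.symm
  m_c := by simp [elementsMul]
  id_m := by
    apply pullback.hom_ext
    · rw [lift_elementsMul_fst]
      refine Eq.trans (G.mul_congr (h' := ?_) ?_ rfl) ((G.one_mul (α.act ≫ α.p) _ ?_).trans rfl)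
      · simp [α.act_p]
      · simp
      · simp [α.act_p]
    · rw [lift_elementsMul_snd]
  m_id := by
    apply pullback.hom_ext
    · rw [lift_elementsMul_fst]
      refine Eq.trans (G.mul_congr (g' := (pullback.snd G.c α.p ≫ α.p) ≫ G.e)
        (h' := ?_) rfl ?_) (G.mul_one _ _ _)
      · simp [pullback.condition]
      · simp
    · rw [lift_elementsMul_snd]
      simp
  assoc f g h hfg hgh := by
    apply pullback.hom_ext
    · simp only [lift_elementsMul_fst]
      rw [mul_mul]
    · simp only [lift_elementsMul_snd]
  i_d := by
    rw [comp_act]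
    calc _ = α.smul (pullback.fst G.c α.p ≫ G.i)
          (α.smul (pullback.fst G.c α.p) (pullback.snd G.c α.p) pullback.condition) (by simp) :=
          α.smul_congr (by simp) (by rw [← act_eq_smul]; simp)
      _ = α.smul (G.mul (pullback.fst G.c α.p ≫ G.i) (pullback.fst G.c α.p) (by simp))
          (pullback.snd G.c α.p) (by simp [pullback.condition]) := (α.mul_smul _ _ _ _ _).symm
      _ = α.smul ((pullback.fst G.c α.p ≫ G.c) ≫ G.e)
          (pullback.snd G.c α.p) (by simp [pullback.condition]) :=
          α.smul_congr (G.inv_mul _ _) rfl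
      _ = _ := α.one_smul _ _ _
  i_c := by simp
  m_i := by
    apply pullback.hom_ext
    · rw [lift_elementsMul_fst]
      refine Eq.trans (G.mul_congr (h' := ?_) (Category.id_comp _) (pullback.lift_fst _ _ _)) ?_
      · simp
      rw [mul_inv]
      simp [← α.act_p]
    · rw [lift_elementsMul_snd]
      simp
  i_m := by
    apply pullback.hom_ext
    · rw [lift_elementsMul_fst]
      refine Eq.trans (G.mul_congr (h' := ?_) (pullback.lift_fst _ _ _) (Category.id_comp _)) ?_
      · simp
      rw [inv_mul]
      simp [pullback.condition]
    · rw [lift_elementsMul_snd]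
      simp

/-- The projection from the groupoid of elements. -/
noncomputable def proj : α.elements ⟶ G :=
  Hom.mk (H := α.elements) α.p (pullback.fst _ _) α.act_p.symm pullback.condition
    (pullback.lift_fst _ _ _) (by
      change α.elementsMul ≫ pullback.fst _ _ = _
      rw [elementsMul, pullback.lift_fst, mul]
      congr 1)

theorem isDiscreteFibration_proj : IsDiscreteFibration α.proj :=
  IsPullback.of_hasPullback G.c α.p

end Action

end Action

/-! ### Connected components, by exactness -/

section Components

variable {C : Type u} [Category.{v} C] [BarrExact C]

/-- `q` exhibits `Q` as the object of connected components of an internal groupoid: two generalized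
objects become equal in it exactly when they are locally connected by an arrow. -/
structure IsComponents (G : InternalGroupoid C) {Q : C} (q : G.obj₀ ⟶ Q) : Prop where
  isRegularEpi : IsRegularEpi q
  w : G.d ≫ q = G.c ≫ q
  exists_arrow ⦃T : C⦄ (x y : T ⟶ G.obj₀) (h : x ≫ q = y ≫ q) :
    ∃ (T' : C) (t : T' ⟶ T) (s : T' ⟶ G.obj₁), IsRegularEpi t ∧
      s ≫ G.d = t ≫ x ∧ s ≫ G.c = t ≫ y

/-- The image of `(d, c)` in `G₀ ⨯ G₀` is an equivalence relation, by identities, inverses and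
composites of arrows; exactness makes it a kernel pair. -/
theorem exists_isComponents (G : InternalGroupoid C) :
    ∃ (Q : C) (q : G.obj₀ ⟶ Q), G.IsComponents q := by
  obtain ⟨R, k, r, hk, hr, hfac⟩ : ∃ (R : C) (k : G.obj₁ ⟶ R) (r : R ⟶ G.obj₀ ⨯ G.obj₀),
      IsRegularEpi k ∧ Mono r ∧ k ≫ r = prod.lift G.d G.c :=
    ⟨_, (Regular.strongEpiMonoFactorisation (prod.lift G.d G.c)).e,
      (Regular.strongEpiMonoFactorisation (prod.lift G.d G.c)).m, inferInstance, inferInstance,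
      (Regular.strongEpiMonoFactorisation (prod.lift G.d G.c)).fac⟩
  have hkd : k ≫ r ≫ prod.fst = G.d := by rw [reassoc_of% hfac, prod.lift_fst]
  have hkc : k ≫ r ≫ prod.snd = G.c := by rw [reassoc_of% hfac, prod.lift_snd]
  have hsymm : ∃ σ : R ⟶ R, σ ≫ r = r ≫ prod.lift prod.snd prod.fst := by
    refine IsRegularEpi.exists_factor_of_mono (t := k) (z := G.i ≫ k) ?_
    ext <;> simp [hkd, hkc]
  obtain ⟨σ, hσ⟩ := hsymm
  have htrans : ∃ τ : pullback (r ≫ prod.snd) (r ≫ prod.fst) ⟶ R,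
      τ ≫ r = prod.lift (pullback.fst _ _ ≫ r ≫ prod.fst) (pullback.snd _ _ ≫ r ≫ prod.snd) := by
    -- Members of the image lift to arrows only over a cover. The composite of the lifts lies in the
    -- image, and membership descends because `r` is monic.
    obtain ⟨T, t, s, ht, hs⟩ := IsRegularEpi.exists_cover k
      (pullback.fst (r ≫ prod.snd) (r ≫ prod.fst))
    obtain ⟨T', t', s', ht', hs'⟩ := IsRegularEpi.exists_cover k
      (t ≫ pullback.snd (r ≫ prod.snd) (r ≫ prod.fst))
    have := IsRegularEpi.comp t' t
    have hc : (t' ≫ s) ≫ G.c = s' ≫ G.d := by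
      rw [← hkc, ← hkd, Category.assoc, reassoc_of% hs, reassoc_of% hs', pullback.condition]
    refine IsRegularEpi.exists_factor_of_mono (t := t' ≫ t) (z := G.mul (t' ≫ s) s' hc ≫ k) ?_
    ext
    · simp only [Category.assoc, hkd, mul_d, prod.lift_fst]
      rw [← hkd, reassoc_of% hs]
    · simp only [Category.assoc, hkc, mul_c, prod.lift_snd]
      rw [← hkc, reassoc_of% hs']
  obtain ⟨τ, hτ⟩ := htrans
  have hτ₁ : τ ≫ r ≫ prod.fst = pullback.fst _ _ ≫ r ≫ prod.fst := by
    rw [reassoc_of% hτ, prod.lift_fst]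
  have hτ₂ : τ ≫ r ≫ prod.snd = pullback.snd _ _ ≫ r ≫ prod.snd := by
    rw [reassoc_of% hτ, prod.lift_snd]
  have hmono : JointlyMono₂ (r ≫ prod.fst) (r ≫ prod.snd) :=
    ⟨fun Y f g h₁ h₂ ↦ by rw [← cancel_mono r]; ext <;> simp [h₁, h₂]⟩
  have hrel : EquivalenceRelation (r ≫ prod.fst) (r ≫ prod.snd) :=
    { hmono with
      r := G.e ≫ k
      reflexivity₁ := by simp [hkd]
      reflexivity₂ := by simp [hkc]
      s := σ
      symmetry₁ := by rw [reassoc_of% hσ, prod.lift_fst]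
      symmetry₂ := by rw [reassoc_of% hσ, prod.lift_snd]
      c := _
      isLimit := pullbackIsPullback _ _
      t := τ
      transitivity₁ := hτ₁
      transitivity₂ := hτ₂ }
  have := hrel.isEquivalenceRelation
  obtain ⟨Q', q', hq'⟩ := BarrExact.exists_isKernelPair (r ≫ prod.fst) (r ≫ prod.snd)
  -- `q'` need not be epic; its regular epi part has the same kernel pair, since the other factor is
  -- monic.
  rw [← (Regular.strongEpiMonoFactorisation q').fac] at hq'
  have hq := hq'.cancel_right_of_mono
  refine ⟨_, (Regular.strongEpiMonoFactorisation q').e, inferInstance, ?_, fun T x y hxy ↦ ?_⟩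
  · rw [← hkd, ← hkc, Category.assoc k, hq.w, Category.assoc k]
  · obtain ⟨T', t, s, ht, hs⟩ := IsRegularEpi.exists_cover k (hq.lift x y hxy)
    refine ⟨T', t, s, ht, ?_, ?_⟩
    · rw [← hkd, reassoc_of% hs, hq.lift_fst]
    · rw [← hkc, reassoc_of% hs, hq.lift_snd]

end Components

/-! ### Functors into a discrete fibration -/

section DiscreteFibration

variable {C : Type u} [Category.{v} C] [HasFiniteLimits C]

/-- A morphism of graphs into a discrete fibration lying over a functor is a functor. -/
noncomputable def IsDiscreteFibration.liftHom {A B G : InternalGroupoid C} {K : A ⟶ B}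
    (hK : IsDiscreteFibration K) (b : G ⟶ B) (l₀ : G.obj₀ ⟶ A.obj₀) (l₁ : G.obj₁ ⟶ A.obj₁)
    (h₀ : l₀ ≫ K.f₀ = b.f₀) (h₁ : l₁ ≫ K.f₁ = b.f₁) (hd : l₁ ≫ A.d = G.d ≫ l₀)
    (hc : l₁ ≫ A.c = G.c ≫ l₀) : G ⟶ A :=
  Hom.mk l₀ l₁ hd hc
    (by
      apply IsPullback.hom_ext hK
      · rw [Category.assoc, h₁, b.w_e, map_one, h₀]
      · simp [hc])
    (by
      apply IsPullback.hom_ext hK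
      · rw [Category.assoc, h₁, b.w_m, Category.assoc, K.w_m, ← Category.assoc, pullback.map_comp]
        congr 2 <;> simp [h₀, h₁]
      · calc (G.m ≫ l₁) ≫ A.c = (G.m ≫ G.c) ≫ l₀ := by rw [Category.assoc, hc, Category.assoc]
          _ = pullback.snd _ _ ≫ l₁ ≫ A.c := by rw [G.m_c, Category.assoc, hc]
          _ = _ := by rw [Category.assoc, A.m_c]; simp)

end DiscreteFibration

/-! ### The two commuting actions on arrows `F h ⟶ g` -/

section Comma

variable {C : Type u} [Category.{v} C] [HasFiniteLimits C] {H G : InternalGroupoid C} (F : H ⟶ G)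
  {T : C}

/-- The action of an arrow `k ⟶ h` of `H` on an arrow `F h ⟶ g` by precomposition. -/
noncomputable def commaPrecomp (f : T ⟶ H.obj₁) (x : T ⟶ pullback F.f₀ G.d)
    (h : f ≫ H.c = x ≫ pullback.fst _ _) : T ⟶ pullback F.f₀ G.d :=
  pullback.lift (f ≫ H.d)
    (G.mul (f ≫ F.f₁) (x ≫ pullback.snd _ _) (by
      simp [map_c, reassoc_of% h, pullback.condition])) (by simp [map_d])

theorem commaPrecomp_congr {f f' : T ⟶ H.obj₁} {x x' : T ⟶ pullback F.f₀ G.d}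
    {h : f ≫ H.c = x ≫ pullback.fst _ _} {h' : f' ≫ H.c = x' ≫ pullback.fst _ _}
    (hf : f = f') (hx : x = x') : commaPrecomp F f x h = commaPrecomp F f' x' h' := by
  subst hf hx; rfl

theorem comp_commaPrecomp {T' : C} (t : T' ⟶ T) (f : T ⟶ H.obj₁) (x : T ⟶ pullback F.f₀ G.d)
    (h : f ≫ H.c = x ≫ pullback.fst _ _) :
    t ≫ commaPrecomp F f x h = commaPrecomp F (t ≫ f) (t ≫ x) (by simp [h]) := by
  apply pullback.hom_ext
  · simp [commaPrecomp]
  · simp only [commaPrecomp, Category.assoc, pullback.lift_snd, comp_mul]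

theorem commaPrecomp_fst (f : T ⟶ H.obj₁) (x : T ⟶ pullback F.f₀ G.d)
    (h : f ≫ H.c = x ≫ pullback.fst _ _) :
    commaPrecomp F f x h ≫ pullback.fst _ _ = f ≫ H.d := by
  simp [commaPrecomp]

theorem commaPrecomp_target (f : T ⟶ H.obj₁) (x : T ⟶ pullback F.f₀ G.d)
    (h : f ≫ H.c = x ≫ pullback.fst _ _) :
    commaPrecomp F f x h ≫ pullback.snd _ _ ≫ G.c = x ≫ pullback.snd _ _ ≫ G.c := by
  simp [commaPrecomp]

theorem commaPrecomp_one (y : T ⟶ H.obj₀) (x : T ⟶ pullback F.f₀ G.d)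
    (h : (y ≫ H.e) ≫ H.c = x ≫ pullback.fst _ _) :
    commaPrecomp F (y ≫ H.e) x h = x := by
  have hy : y = x ≫ pullback.fst _ _ := by simpa using h
  apply pullback.hom_ext
  · simp [commaPrecomp, hy]
  · rw [commaPrecomp, pullback.lift_snd]
    refine (G.mul_congr (h' := ?_) (map_one F y) rfl).trans (G.one_mul _ _ _)
    simp [hy, pullback.condition]

theorem commaPrecomp_mul (f g : T ⟶ H.obj₁) (x : T ⟶ pullback F.f₀ G.d)
    (hfg : f ≫ H.c = g ≫ H.d) (h : g ≫ H.c = x ≫ pullback.fst _ _) :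
    commaPrecomp F (H.mul f g hfg) x (by simp [h]) =
      commaPrecomp F f (commaPrecomp F g x h) (by rw [commaPrecomp_fst, hfg]) := by
  apply pullback.hom_ext
  · simp [commaPrecomp]
  · simp only [commaPrecomp, pullback.lift_snd, map_mul]
    exact G.mul_mul _ _ _ _ _

/-- The action of `H` by precomposition on the object `H₀ ×_{(f₀, d)} G₁` of arrows `F h ⟶ g`. -/
noncomputable def commaAction : Action H where
  X := pullback F.f₀ G.d
  p := pullback.fst _ _
  act := commaPrecomp F (pullback.fst _ _) (pullback.snd _ _) pullback.condition
  act_p := commaPrecomp_fst F _ _ _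
  one_act := by
    rw [comp_commaPrecomp]
    refine (commaPrecomp_congr F (h' := ?_) (pullback.lift_fst _ _ _)
      (pullback.lift_snd _ _ _)).trans (commaPrecomp_one F _ _ _)
    simp
  mul_act f g x hfg hgx := by
    simp only [comp_commaPrecomp, pullback.lift_fst, pullback.lift_snd]
    exact commaPrecomp_mul F f g x hfg hgx

theorem commaAction_smul (f : T ⟶ H.obj₁) (x : T ⟶ pullback F.f₀ G.d)
    (h : f ≫ H.c = x ≫ pullback.fst _ _) :
    (commaAction F).smul f x h = commaPrecomp F f x h := by
  refine (comp_commaPrecomp F _ _ _ pullback.condition).trans (commaPrecomp_congr F ?_ ?_)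
  · exact pullback.lift_fst _ _ _
  · exact pullback.lift_snd _ _ _

/-- The action of `G` on arrows `F h ⟶ g` by postcomposition with inverses. -/
noncomputable def commaTranslate (f : T ⟶ G.obj₁) (x : T ⟶ pullback F.f₀ G.d)
    (h : f ≫ G.c = x ≫ pullback.snd _ _ ≫ G.c) : T ⟶ pullback F.f₀ G.d :=
  pullback.lift (x ≫ pullback.fst _ _) (G.mul (x ≫ pullback.snd _ _) (f ≫ G.i) (by simp [h]))
    (by simp [pullback.condition])

theorem commaTranslate_congr {f f' : T ⟶ G.obj₁} {x x' : T ⟶ pullback F.f₀ G.d}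
    {h : f ≫ G.c = x ≫ pullback.snd _ _ ≫ G.c} {h' : f' ≫ G.c = x' ≫ pullback.snd _ _ ≫ G.c}
    (hf : f = f') (hx : x = x') : commaTranslate F f x h = commaTranslate F f' x' h' := by
  subst hf hx; rfl

theorem comp_commaTranslate {T' : C} (t : T' ⟶ T) (f : T ⟶ G.obj₁) (x : T ⟶ pullback F.f₀ G.d)
    (h : f ≫ G.c = x ≫ pullback.snd _ _ ≫ G.c) :
    t ≫ commaTranslate F f x h = commaTranslate F (t ≫ f) (t ≫ x) (by simp [h]) := by
  apply pullback.hom_ext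
  · simp [commaTranslate]
  · simp only [commaTranslate, Category.assoc, pullback.lift_snd, comp_mul]

theorem commaTranslate_target (f : T ⟶ G.obj₁) (x : T ⟶ pullback F.f₀ G.d)
    (h : f ≫ G.c = x ≫ pullback.snd _ _ ≫ G.c) :
    commaTranslate F f x h ≫ pullback.snd _ _ ≫ G.c = f ≫ G.d := by
  simp [commaTranslate]

theorem commaTranslate_one (y : T ⟶ G.obj₀) (x : T ⟶ pullback F.f₀ G.d)
    (h : (y ≫ G.e) ≫ G.c = x ≫ pullback.snd _ _ ≫ G.c) :
    commaTranslate F (y ≫ G.e) x h = x := by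
  apply pullback.hom_ext
  · simp [commaTranslate]
  · rw [commaTranslate, pullback.lift_snd]
    exact (G.mul_congr (h' := by simpa using h.symm) rfl (G.one_inv y)).trans (G.mul_one _ _ _)

/-- Inversion reverses products, which turns postcomposition into a contravariant action. -/
theorem commaTranslate_mul (f g : T ⟶ G.obj₁) (x : T ⟶ pullback F.f₀ G.d)
    (hfg : f ≫ G.c = g ≫ G.d) (h : g ≫ G.c = x ≫ pullback.snd _ _ ≫ G.c) :
    commaTranslate F (G.mul f g hfg) x (by simp [h]) =
      commaTranslate F f (commaTranslate F g x h) (by rw [commaTranslate_target, hfg]) := by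
  apply pullback.hom_ext
  · simp [commaTranslate]
  · simp only [commaTranslate, pullback.lift_snd, mul_inv_rev]
    exact (G.mul_mul _ _ _ _ _).symm

theorem commaTranslate_fst (f : T ⟶ G.obj₁) (x : T ⟶ pullback F.f₀ G.d)
    (h : f ≫ G.c = x ≫ pullback.snd _ _ ≫ G.c) :
    commaTranslate F f x h ≫ pullback.fst _ _ = x ≫ pullback.fst _ _ := by
  simp [commaTranslate]

/-- Associativity: `F k · (x · f⁻¹) = (F k · x) · f⁻¹`. Hence translation descends to the orbits of
`H`. -/
theorem commaTranslate_precomp (f : T ⟶ G.obj₁) (k : T ⟶ H.obj₁) (x : T ⟶ pullback F.f₀ G.d)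
    (h : f ≫ G.c = x ≫ pullback.snd _ _ ≫ G.c) (hk : k ≫ H.c = x ≫ pullback.fst _ _) :
    commaTranslate F f (commaPrecomp F k x hk) (by rw [commaPrecomp_target, h]) =
      commaPrecomp F k (commaTranslate F f x h) (by rw [commaTranslate_fst, hk]) := by
  apply pullback.hom_ext
  · simp [commaTranslate, commaPrecomp]
  · simp only [commaTranslate, commaPrecomp, pullback.lift_snd]
    exact G.mul_mul _ _ _ _ _

/-- The identity of `F h`, as an arrow `F h ⟶ F h`. -/
noncomputable def commaUnit : H.obj₀ ⟶ pullback F.f₀ G.d :=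
  pullback.lift (𝟙 _) (F.f₀ ≫ G.e) (by simp)

/-- An arrow `k : h ⟶ h'` identifies the unit at `h` with the inverse of `F k`. -/
theorem commaPrecomp_translate_unit (k : T ⟶ H.obj₁) :
    commaPrecomp F k
      (commaTranslate F (k ≫ F.f₁) (k ≫ H.c ≫ commaUnit F) (by simp [map_c, commaUnit]))
      (by simp [commaTranslate_fst, commaUnit]) = k ≫ H.d ≫ commaUnit F := by
  apply pullback.hom_ext
  · simp [commaPrecomp, commaUnit]
  · simp only [commaTranslate, commaPrecomp, pullback.lift_snd, Category.assoc, commaUnit]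
    -- The arrow component is `F k · (1 · (F k)⁻¹)`, which collapses from the inside out.
    refine (G.mul_congr (h' := ?_) rfl
      ((G.mul_congr (f' := (k ≫ H.c ≫ F.f₀) ≫ G.e) (h' := ?_) ?_ rfl).trans
      (G.one_mul _ _ _))).trans ?_
    · simp
    · simp [map_c]
    · simp
    · refine (G.mul_congr (h' := ?_) rfl (Category.assoc k F.f₁ G.i).symm).trans
        ((G.mul_inv _ _).trans ?_)
      · simp
      · simp only [Category.assoc]
        rw [← Category.assoc F.f₁, map_d, Category.assoc]

end Comma

/-! ### Fullness in terms of local preimages -/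

section Full

variable {C : Type u} [Category.{v} C] [Regular C] {H G : InternalGroupoid C} (F : H ⟶ G)

/-- A functor is full iff arrows between objects in its image locally have preimages. -/
theorem isFull_iff_exists_cover : IsFull F ↔
    ∀ ⦃T : C⦄ (x y : T ⟶ H.obj₀) (f : T ⟶ G.obj₁), f ≫ G.d = x ≫ F.f₀ → f ≫ G.c = y ≫ F.f₀ →
      ∃ (T' : C) (t : T' ⟶ T) (k : T' ⟶ H.obj₁), IsRegularEpi t ∧
        k ≫ H.d = t ≫ x ∧ k ≫ H.c = t ≫ y ∧ k ≫ F.f₁ = t ≫ f := by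
  constructor
  · intro hF T x y f hd hc
    have : IsRegularEpi (phi F) := hF
    obtain ⟨T', t, k, ht, hk⟩ := IsRegularEpi.exists_cover (phi F)
      (pullback.lift (prod.lift x y) f (by ext <;> simp [hd, hc]))
    refine ⟨T', t, k, ht, ?_, ?_, ?_⟩
    · simpa [phi] using congr($hk ≫ pullback.fst _ _ ≫ prod.fst)
    · simpa [phi] using congr($hk ≫ pullback.fst _ _ ≫ prod.snd)
    · simpa [phi] using congr($hk ≫ pullback.snd _ _)
  · intro hF
    have hw := pullback.condition (f := prod.map F.f₀ F.f₀) (g := prod.lift G.d G.c)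
    -- For the tautological element of the pullback, the local preimage `k` satisfies `k ≫ phi F =
    -- t`, so `phi F` is the second factor of a regular epimorphism.
    obtain ⟨T, t, k, ht, hd, hc, hk⟩ := hF
      (pullback.fst (prod.map F.f₀ F.f₀) (prod.lift G.d G.c) ≫ prod.fst)
      (pullback.fst (prod.map F.f₀ F.f₀) (prod.lift G.d G.c) ≫ prod.snd)
      (pullback.snd (prod.map F.f₀ F.f₀) (prod.lift G.d G.c))
      (by simpa using congr($hw ≫ prod.fst).symm) (by simpa using congr($hw ≫ prod.snd).symm)
    have h : k ≫ phi F = t := by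
      apply pullback.hom_ext
      · ext
        · simpa [phi] using hd
        · simpa [phi] using hc
      · simpa [phi] using hk
    have : IsRegularEpi (k ≫ phi F) := by rwa [h]
    exact IsRegularEpi.of_comp k (phi F)

end Full

/-! ### Comprehensive factorization; final functors are full and essentially surjective -/

section Comprehension

variable {C : Type u} [Category.{v} C] [BarrExact C] {H G : InternalGroupoid C} (F : H ⟶ G)

/-- `q` is the quotient of the object of arrows `F h ⟶ g` by the precomposition action of `H`. -/
structure IsCommaQuotient {Q : C} (q : pullback F.f₀ G.d ⟶ Q) : Prop where
  isRegularEpi : IsRegularEpi q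
  precomp_comp ⦃T : C⦄ (k : T ⟶ H.obj₁) (x : T ⟶ pullback F.f₀ G.d)
    (h : k ≫ H.c = x ≫ pullback.fst _ _) : commaPrecomp F k x h ≫ q = x ≫ q
  exists_precomp_eq ⦃T : C⦄ (x y : T ⟶ pullback F.f₀ G.d) (h : x ≫ q = y ≫ q) :
    ∃ (T' : C) (t : T' ⟶ T) (k : T' ⟶ H.obj₁) (_ : IsRegularEpi t)
      (hk : k ≫ H.c = (t ≫ y) ≫ pullback.fst _ _), t ≫ x = commaPrecomp F k (t ≫ y) hk

/-- Orbits of an action are the components of its groupoid of elements. -/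
theorem exists_isCommaQuotient :
    ∃ (Q : C) (q : pullback F.f₀ G.d ⟶ Q), IsCommaQuotient F q := by
  obtain ⟨Q, q, hq⟩ := (commaAction F).elements.exists_isComponents
  refine ⟨Q, q, hq.isRegularEpi, fun T k x h ↦ ?_, fun T x y h ↦ ?_⟩
  · rw [← commaAction_smul]
    refine ((Category.assoc _ _ _).trans (pullback.lift k x h ≫= hq.w)).trans ?_
    exact pullback.lift_snd_assoc _ _ _ _
  · obtain ⟨T', t, s, ht, hx, hy⟩ := hq.exists_arrow x y h
    change T' ⟶ pullback H.c (pullback.fst F.f₀ G.d) at s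
    change s ≫ pullback.snd _ _ = t ≫ y at hy
    refine ⟨T', t, s ≫ pullback.fst _ _, ht, ?_, ?_⟩
    · rw [← hy, Category.assoc, pullback.condition, Category.assoc]
    · refine hx.symm.trans ((comp_commaPrecomp F s _ _ pullback.condition).trans ?_)
      exact commaPrecomp_congr F rfl hy

/-- The `G`-action on the components of the comma object of `F`, whose groupoid of elements is the
discrete fibration part of the comprehensive factorization of `F`. -/
theorem exists_comprehension :
    ∃ (β : Action G) (q : pullback F.f₀ G.d ⟶ β.X), IsCommaQuotient F q ∧
      q ≫ β.p = pullback.snd _ _ ≫ G.c ∧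
      ∀ ⦃T : C⦄ (f : T ⟶ G.obj₁) (x : T ⟶ pullback F.f₀ G.d)
        (h : f ≫ G.c = x ≫ pullback.snd _ _ ≫ G.c) (h' : f ≫ G.c = (x ≫ q) ≫ β.p),
        β.smul f (x ≫ q) h' = commaTranslate F f x h ≫ q := by
  obtain ⟨Q, q, hq⟩ := exists_isCommaQuotient F
  have := hq.isRegularEpi
  obtain ⟨p, hp⟩ : ∃ p : Q ⟶ G.obj₀, q ≫ p = pullback.snd _ _ ≫ G.c := by
    refine IsRegularEpi.exists_desc q _ fun T x y h ↦ ?_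
    obtain ⟨T', t, k, ht, hk, hx⟩ := hq.exists_precomp_eq x y h
    rw [← cancel_epi t, reassoc_of% hx, commaPrecomp_target, Category.assoc]
  have htrans {T : C} (f : T ⟶ G.obj₁) (x y : T ⟶ pullback F.f₀ G.d)
      (hx : f ≫ G.c = x ≫ pullback.snd _ _ ≫ G.c) (hy : f ≫ G.c = y ≫ pullback.snd _ _ ≫ G.c)
      (h : x ≫ q = y ≫ q) : commaTranslate F f x hx ≫ q = commaTranslate F f y hy ≫ q := by
    -- Representatives of one class differ locally by a precomposition, which commutes with
    -- translation and is absorbed by `q`.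
    obtain ⟨T', t, k, ht, hk, e⟩ := hq.exists_precomp_eq x y h
    rw [← cancel_epi t, ← Category.assoc, ← Category.assoc, comp_commaTranslate,
      comp_commaTranslate, commaTranslate_congr F (h' := ?_) rfl e, commaTranslate_precomp,
      hq.precomp_comp]
    rw [commaPrecomp_target, Category.assoc, Category.assoc, hy]
  have hcov : (pullback.fst (pullback.snd G.c p) q ≫ pullback.fst G.c p) ≫ G.c =
      pullback.snd (pullback.snd G.c p) q ≫ pullback.snd F.f₀ G.d ≫ G.c := by
    rw [← hp, ← pullback.condition_assoc, Category.assoc, pullback.condition]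
  -- The action descends along the pullback of `q` to `G₁ ×_{G₀} Q`, again a regular epimorphism.
  obtain ⟨act, hact⟩ : ∃ act : pullback G.c p ⟶ Q, pullback.fst (pullback.snd G.c p) q ≫ act =
      commaTranslate F (pullback.fst (pullback.snd G.c p) q ≫ pullback.fst G.c p)
        (pullback.snd (pullback.snd G.c p) q) hcov ≫ q := by
    refine IsRegularEpi.exists_desc _ _ fun T x y h ↦ ?_
    rw [← Category.assoc, ← Category.assoc, comp_commaTranslate, comp_commaTranslate]
    have hx : (y ≫ pullback.fst (pullback.snd G.c p) q ≫ pullback.fst G.c p) ≫ G.c =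
        (x ≫ pullback.snd (pullback.snd G.c p) q) ≫ pullback.snd F.f₀ G.d ≫ G.c := by
      rw [← reassoc_of% h, Category.assoc, hcov, Category.assoc]
    have hxy : x ≫ pullback.fst (pullback.snd G.c p) q ≫ pullback.fst G.c p =
        y ≫ pullback.fst (pullback.snd G.c p) q ≫ pullback.fst G.c p := by rw [reassoc_of% h]
    rw [commaTranslate_congr F (h' := hx) hxy rfl]
    apply htrans
    rw [Category.assoc, Category.assoc, ← pullback.condition, reassoc_of% h]
  have hsmul {T : C} (f : T ⟶ G.obj₁) (x : T ⟶ pullback F.f₀ G.d)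
      (h : f ≫ G.c = x ≫ pullback.snd _ _ ≫ G.c) (h' : f ≫ G.c = (x ≫ q) ≫ p) :
      pullback.lift f (x ≫ q) h' ≫ act = commaTranslate F f x h ≫ q := by
    have := pullback.lift (pullback.lift f (x ≫ q) h') x (by simp) ≫= hact
    rw [pullback.lift_fst_assoc] at this
    rw [this, ← Category.assoc, comp_commaTranslate]
    exact congr($(commaTranslate_congr F (by simp) (by simp)) ≫ q)
  have hlift {T : C} (f : T ⟶ G.obj₁) (x : T ⟶ Q) (y : T ⟶ pullback F.f₀ G.d) (hxy : x = y ≫ q)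
      (h : f ≫ G.c = y ≫ pullback.snd _ _ ≫ G.c) (h' : f ≫ G.c = x ≫ p) :
      pullback.lift f x h' ≫ act = commaTranslate F f y h ≫ q := by
    subst hxy; exact hsmul f y h h'
  have hprecomp {T T' : C} (t : T' ⟶ T) (f : T ⟶ G.obj₁) (x : T ⟶ Q) (h : f ≫ G.c = x ≫ p) :
      t ≫ pullback.lift f x h ≫ act = pullback.lift (t ≫ f) (t ≫ x) (by simp [h]) ≫ act := by
    rw [← Category.assoc]
    congr 1
    ext <;> simp
  have act_p : act ≫ p = pullback.fst _ _ ≫ G.d := by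
    rw [← cancel_epi (pullback.fst (pullback.snd G.c p) q), reassoc_of% hact, hp,
      commaTranslate_target, Category.assoc]
  refine ⟨⟨Q, p, act, act_p, ?_, ?_⟩, q, hq, hp, fun T f x h h' ↦ hsmul f x h h'⟩
  · rw [← cancel_epi q, hprecomp, hlift _ _ (𝟙 _) (by simp) (by simp [hp]),
      commaTranslate_congr F (f' := (pullback.snd _ _ ≫ G.c) ≫ G.e) (h' := by simp) ?_ rfl,
      commaTranslate_one]
    · simp
    · rw [reassoc_of% hp, Category.assoc]
  · intro T f g x hfg hgx
    -- A representative `y` of `x` exists only over a cover; equality is checked there.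
    obtain ⟨T', t, y, ht, hy⟩ := IsRegularEpi.exists_cover q x
    have hgy : (t ≫ g) ≫ G.c = y ≫ pullback.snd _ _ ≫ G.c := by
      rw [← hp, reassoc_of% hy, Category.assoc, hgx]
    have hfg' : (t ≫ f) ≫ G.c = (t ≫ g) ≫ G.d := by simp [hfg]
    have hm : (t ≫ G.mul f g hfg) ≫ G.c = y ≫ pullback.snd _ _ ≫ G.c := by
      rw [comp_mul, mul_c, hgy]
    rw [← cancel_epi t, hprecomp, hprecomp, hlift _ _ y hy.symm hm,
      hlift (t ≫ f) _ (commaTranslate F (t ≫ g) y hgy) ?_ (by rw [commaTranslate_target, hfg']),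
      ← commaTranslate_mul F _ _ _ hfg' hgy]
    · exact congr($(commaTranslate_congr F (G.comp_mul _ _ _ _) rfl) ≫ q)
    · rw [hprecomp]
      exact hlift _ _ _ hy.symm _ _

variable {F}

/-- The comparison functor from `H` to the groupoid of elements of the comprehension of `F`. -/
theorem exists_comprehension_unit {β : Action G} {q : pullback F.f₀ G.d ⟶ β.X}
    (hq : IsCommaQuotient F q) (hp : q ≫ β.p = pullback.snd _ _ ≫ G.c)
    (hβ : ∀ ⦃T : C⦄ (f : T ⟶ G.obj₁) (x : T ⟶ pullback F.f₀ G.d)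
        (h : f ≫ G.c = x ≫ pullback.snd _ _ ≫ G.c) (h' : f ≫ G.c = (x ≫ q) ≫ β.p),
        β.smul f (x ≫ q) h' = commaTranslate F f x h ≫ q) :
    ∃ a : H ⟶ β.elements, a ≫ β.proj = F ∧ Hom.f₀ a = commaUnit F ≫ q := by
  have h₀ : (commaUnit F ≫ q) ≫ β.p = F.f₀ := by
    rw [Category.assoc, hp]; simp [commaUnit]
  have hc : F.f₁ ≫ G.c = (H.c ≫ commaUnit F ≫ q) ≫ β.p := by
    rw [Category.assoc, h₀, map_c]
  have hd : pullback.lift F.f₁ (H.c ≫ commaUnit F ≫ q) hc ≫ β.act =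
      H.d ≫ commaUnit F ≫ q := by
    -- Taken at the universal arrow of `H`: the unit at its domain and the translate by `F k` of the
    -- unit at its codomain lie in one orbit.
    have h := commaPrecomp_translate_unit F (𝟙 _)
    have h1 := hβ F.f₁ (H.c ≫ commaUnit F) (by simp [map_c, commaUnit])
      (by simpa using hc)
    have h2 := congr($h ≫ q)
    rw [hq.precomp_comp] at h2
    simp only [Category.id_comp, Category.assoc] at h1 h2
    exact h1.trans h2
  refine ⟨β.isDiscreteFibration_proj.liftHom F (commaUnit F ≫ q)
    (pullback.lift F.f₁ (H.c ≫ commaUnit F ≫ q) hc) h₀ (pullback.lift_fst _ _ _) hd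
    (pullback.lift_snd _ _ _), Hom.ext h₀ (pullback.lift_fst _ _ _), rfl⟩

/-- `l` is the object part of the filler against `β.proj` over the identity of `G`; its equivariance
is the filler's compatibility with domains. -/
theorem IsFinal.exists_comprehension_section (hF : IsFinal F) :
    ∃ (β : Action G) (q : pullback F.f₀ G.d ⟶ β.X), IsCommaQuotient F q ∧
      q ≫ β.p = pullback.snd _ _ ≫ G.c ∧
      ∃ l : G.obj₀ ⟶ β.X, l ≫ β.p = 𝟙 _ ∧ F.f₀ ≫ l = commaUnit F ≫ q ∧
      ∀ ⦃T : C⦄ (f : T ⟶ G.obj₁) (x : T ⟶ pullback F.f₀ G.d)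
        (h : f ≫ G.c = x ≫ pullback.snd _ _ ≫ G.c), f ≫ G.c ≫ l = x ≫ q →
        f ≫ G.d ≫ l = commaTranslate F f x h ≫ q := by
  obtain ⟨β, q, hq, hp, hβ⟩ := exists_comprehension F
  obtain ⟨a, ha, ha₀⟩ := exists_comprehension_unit hq hp hβ
  obtain ⟨l, ⟨hl, hl'⟩, -⟩ := hF β.proj β.isDiscreteFibration_proj a (𝟙 G)
    (by rw [ha, Category.comp_id])
  obtain ⟨l₀, l₁, hp₀, hp₁, hd, hc, ha'⟩ :
      ∃ (l₀ : G.obj₀ ⟶ β.X) (l₁ : G.obj₁ ⟶ pullback G.c β.p), l₀ ≫ β.p = 𝟙 _ ∧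
        l₁ ≫ pullback.fst _ _ = 𝟙 _ ∧ l₁ ≫ β.act = G.d ≫ l₀ ∧
        l₁ ≫ pullback.snd _ _ = G.c ≫ l₀ ∧ F.f₀ ≫ l₀ = commaUnit F ≫ q :=
    ⟨l.f₀, l.f₁, congrArg Hom.f₀ hl', congrArg Hom.f₁ hl', l.w_d, l.w_c,
      (congrArg Hom.f₀ hl).trans ha₀⟩
  refine ⟨β, q, hq, hp, l₀, hp₀, ha', fun T f x h hx ↦ ?_⟩
  have h' : f ≫ G.c = (x ≫ q) ≫ β.p := by rw [Category.assoc, hp, h]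
  rw [← hβ f x h h', ← hd, ← Category.assoc, Action.comp_act]
  refine β.smul_congr ?_ ?_
  · rw [Category.assoc, hp₁, Category.comp_id]
  · rw [Category.assoc, hc, hx]

theorem IsFinal.isEssSurj (hF : IsFinal F) : IsEssSurj F := by
  obtain ⟨β, q, hq, hp, l, hl, -⟩ := hF.exists_comprehension_section
  have := hq.isRegularEpi
  have : IsSplitEpi β.p := ⟨⟨⟨l, hl⟩⟩⟩
  rw [IsEssSurj, ← hp]
  exact IsRegularEpi.comp q β.p

theorem IsFinal.isFull (hF : IsFinal F) : IsFull F := by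
  rw [isFull_iff_exists_cover]
  intro T x y f hfd hfc
  obtain ⟨β, q, hq, hp, l, hl, hl₀, hl₁⟩ := hF.exists_comprehension_section
  have hc : f ≫ G.c = (y ≫ commaUnit F) ≫ pullback.snd _ _ ≫ G.c := by
    simp [commaUnit, hfc]
  -- `[1_{F x}] = l (F x) = f • l (F y) = f • [1_{F y}]`.
  have key : (x ≫ commaUnit F) ≫ q = commaTranslate F f (y ≫ commaUnit F) hc ≫ q := by
    rw [← hl₁ f _ hc (by rw [reassoc_of% hfc, hl₀, Category.assoc]), reassoc_of% hfd, hl₀,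
      Category.assoc]
  obtain ⟨T', t, k, ht, hk, e⟩ := hq.exists_precomp_eq _ _ key
  have hkd : k ≫ H.d = t ≫ x := by
    simpa [commaPrecomp, commaUnit] using congr($e ≫ pullback.fst _ _).symm
  have hkc : k ≫ H.c = t ≫ y := by simpa [commaTranslate, commaUnit] using hk
  refine ⟨T', t, k, ht, hkd, hkc, ?_⟩
  have hi : (t ≫ commaTranslate F f (y ≫ commaUnit F) hc) ≫ pullback.snd _ _ =
      (t ≫ f) ≫ G.i := by
    rw [Category.assoc, commaTranslate, pullback.lift_snd, Category.assoc t]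
    refine t ≫= (G.mul_congr (f' := (y ≫ F.f₀) ≫ G.e) (h' := ?_) ?_ rfl).trans
      (G.one_mul _ _ _)
    · simp [hfc]
    · simp [commaUnit]
  have hki : (k ≫ F.f₁) ≫ G.c = ((t ≫ f) ≫ G.i) ≫ G.d := by
    simp [map_c, reassoc_of% hkc, hfc]
  -- Arrow components of `e`: the identity of `F x` equals `F k · f⁻¹`.
  have e₂ : (t ≫ x ≫ commaUnit F) ≫ pullback.snd _ _ =
      G.mul (k ≫ F.f₁) ((t ≫ f) ≫ G.i) hki := by
    rw [e, commaPrecomp, pullback.lift_snd]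
    exact G.mul_congr rfl hi
  refine G.eq_of_mul_inv_eq_one _ _ hki (e₂.symm.trans ?_)
  rw [Category.assoc k, map_d, reassoc_of% hkd]
  simp [commaUnit]

end Comprehension

/-! ### Transport in a square from `F` to a discrete fibration -/

section Transport

variable {C : Type u} [Category.{v} C] [HasFiniteLimits C] {H G A B : InternalGroupoid C}
  {F : H ⟶ G} {K : A ⟶ B} {a : H ⟶ A} {b : G ⟶ B} {T : C}

theorem map_c_assoc {Z : C} (k : G.obj₀ ⟶ Z) : F.f₁ ≫ G.c ≫ k = H.c ≫ F.f₀ ≫ k := by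
  rw [← Category.assoc, map_c, Category.assoc]

theorem f₀_w (w : a ≫ K = F ≫ b) : a.f₀ ≫ K.f₀ = F.f₀ ≫ b.f₀ := congrArg Hom.f₀ w

theorem f₁_w (w : a ≫ K = F ≫ b) : a.f₁ ≫ K.f₁ = F.f₁ ≫ b.f₁ := congrArg Hom.f₁ w

namespace IsDiscreteFibration

/-- In a square from `F` to a discrete fibration `K`, an arrow `g : F h ⟶ x` is sent to the lift of
`b g⁻¹` with codomain `a h`. -/
noncomputable def transport (hK : IsDiscreteFibration K) (w : a ≫ K = F ≫ b) :
    pullback F.f₀ G.d ⟶ A.obj₁ :=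
  IsPullback.lift hK ((pullback.snd _ _ ≫ G.i) ≫ b.f₁) (pullback.fst _ _ ≫ a.f₀) (by
    simp [map_c, f₀_w w, pullback.condition_assoc])

variable (hK : IsDiscreteFibration K) (w : a ≫ K = F ≫ b)

theorem transport_map : hK.transport w ≫ K.f₁ = (pullback.snd _ _ ≫ G.i) ≫ b.f₁ :=
  IsPullback.lift_fst hK _ _ _

theorem transport_c : hK.transport w ≫ A.c = pullback.fst _ _ ≫ a.f₀ :=
  IsPullback.lift_snd hK _ _ _

/-- Lifts with prescribed codomain are unique; the identities between transports below reduce to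
this. -/
theorem eq_comp_transport {k : T ⟶ A.obj₁} {x : T ⟶ pullback F.f₀ G.d}
    (h₁ : k ≫ K.f₁ = ((x ≫ pullback.snd _ _) ≫ G.i) ≫ b.f₁)
    (h₀ : k ≫ A.c = (x ≫ pullback.fst _ _) ≫ a.f₀) : k = x ≫ hK.transport w := by
  apply IsPullback.hom_ext hK
  · simp [h₁, transport_map]
  · simp [h₀, transport_c]

theorem commaUnit_transport : commaUnit F ≫ hK.transport w = a.f₀ ≫ A.e := by
  refine (hK.eq_comp_transport w ?_ ?_).symm
  · rw [map_one, f₀_w w, ← map_one, commaUnit, pullback.lift_snd, one_inv]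
  · simp [commaUnit]

/-- Transport along the inverse of a composite. -/
theorem transport_postcomp (x y : T ⟶ pullback F.f₀ G.d) (g : T ⟶ G.obj₁) (k : T ⟶ A.obj₁)
    (h : (x ≫ pullback.snd _ _) ≫ G.c = g ≫ G.d)
    (hy₀ : y ≫ pullback.fst _ _ = x ≫ pullback.fst _ _)
    (hy₁ : y ≫ pullback.snd _ _ = G.mul (x ≫ pullback.snd _ _) g h) (hk : k ≫ K.f₁ = g ≫ b.f₁)
    (hd : k ≫ A.c = (y ≫ hK.transport w) ≫ A.d) :
    k ≫ A.d = x ≫ hK.transport w ≫ A.d := by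
  -- With arrow parts `x` and `y = x g`, this composite lies over `b (g (x g)⁻¹) = b x⁻¹`.
  have : A.mul k (y ≫ hK.transport w) hd = x ≫ hK.transport w := by
    refine hK.eq_comp_transport w ?_ ?_
    · have e : (y ≫ hK.transport w) ≫ K.f₁ =
          G.mul (g ≫ G.i) ((x ≫ pullback.snd _ _) ≫ G.i) (by simp [← h]) ≫ b.f₁ := by
        rw [← mul_inv_rev _ _ _ h, Category.assoc, transport_map, ← Category.assoc,
          ← Category.assoc, hy₁]
      rw [map_mul]
      refine (B.mul_congr (h' := ?_) hk e).trans ?_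
      · simp only [Category.assoc, map_c, map_d]
        rw [← Category.assoc (G.mul _ _ _), mul_d]
        simp
      · rw [← map_mul b _ _ (by simp), mul_inv_cancel_left]
    · rw [mul_c, Category.assoc, transport_c, ← Category.assoc, hy₀]
  rw [← Category.assoc x, ← this, mul_d]

/-- The domain of the transport depends only on the codomain of the arrow, up to preimages of
arrows along `F`. -/
theorem transport_d_eq_of_arrow (x y : T ⟶ pullback F.f₀ G.d) (k : T ⟶ H.obj₁)
    (h : (x ≫ pullback.snd _ _) ≫ G.c = (y ≫ pullback.snd _ _) ≫ G.c)
    (hkd : k ≫ H.d = x ≫ pullback.fst _ _) (hkc : k ≫ H.c = y ≫ pullback.fst _ _)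
    (hk : k ≫ F.f₁ = G.mul (x ≫ pullback.snd _ _) ((y ≫ pullback.snd _ _) ≫ G.i) (by simp [h])) :
    x ≫ hK.transport w ≫ A.d = y ≫ hK.transport w ≫ A.d := by
  have hc : (x ≫ hK.transport w) ≫ A.c = (k ≫ a.f₁) ≫ A.d := by
    rw [Category.assoc, transport_c, Category.assoc, map_d, reassoc_of% hkd]
  -- This composite lies over `b (x⁻¹ (x y⁻¹)) = b y⁻¹`, and its codomain is the image under `a` of
  -- the codomain of `k`.
  have : A.mul (x ≫ hK.transport w) (k ≫ a.f₁) hc = y ≫ hK.transport w := by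
    refine hK.eq_comp_transport w ?_ ?_
    · have e₁ : (x ≫ hK.transport w) ≫ K.f₁ = ((x ≫ pullback.snd _ _) ≫ G.i) ≫ b.f₁ := by
        rw [Category.assoc, transport_map]; simp
      have e₂ : (k ≫ a.f₁) ≫ K.f₁ = G.mul (x ≫ pullback.snd _ _)
          ((y ≫ pullback.snd _ _) ≫ G.i) (by simp [h]) ≫ b.f₁ := by
        rw [← hk, Category.assoc, f₁_w w, Category.assoc]
      rw [map_mul]
      refine (B.mul_congr (h' := ?_) e₁ e₂).trans ?_
      · simp only [Category.assoc, map_c, map_d, i_c_assoc]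
        rw [← Category.assoc (G.mul _ _ _), mul_d]
        simp
      · rw [← map_mul b _ _ (by simp), inv_mul_cancel_left]
    · rw [mul_c, Category.assoc, map_c, reassoc_of% hkc, Category.assoc]
  rw [← Category.assoc y, ← this, mul_d, Category.assoc]

/-- Any filler is compatible with the transport. -/
theorem comp_filler_f₀ {l : G ⟶ A} (hl : F ≫ l = a) (hl' : l ≫ K = b) :
    (pullback.snd F.f₀ G.d ≫ G.c) ≫ l.f₀ = hK.transport w ≫ A.d := by
  -- A filler sends `g⁻¹` to a lift of `b g⁻¹` with codomain `a h`, hence to the transport of `g`.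
  have : (pullback.snd F.f₀ G.d ≫ G.i) ≫ l.f₁ = hK.transport w := by
    apply IsPullback.hom_ext hK
    · rw [transport_map, ← hl', comp_f₁, Category.assoc _ l.f₁]
    · rw [transport_c, ← hl, Category.assoc, map_c]
      simp [pullback.condition_assoc]
  rw [← this, Category.assoc _ l.f₁, map_d]
  simp

end IsDiscreteFibration

end Transport

/-! ### Full and essentially surjective functors are final -/

section Filler

variable {C : Type u} [Category.{v} C] [Regular C] {H G : InternalGroupoid C} {F : H ⟶ G}

theorem isFinal_of_isFull_of_isEssSurj (hfull : IsFull F) (hsurj : IsEssSurj F) : IsFinal F := by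
  intro A B K hK a b w
  have : IsRegularEpi (pullback.snd F.f₀ G.d ≫ G.c) := hsurj
  obtain ⟨l₀, hl₀⟩ : ∃ l₀ : G.obj₀ ⟶ A.obj₀,
      (pullback.snd F.f₀ G.d ≫ G.c) ≫ l₀ = hK.transport w ≫ A.d := by
    refine IsRegularEpi.exists_desc _ _ fun T x y h ↦ ?_
    have h' : (x ≫ pullback.snd F.f₀ G.d) ≫ G.c = (y ≫ pullback.snd F.f₀ G.d) ≫ G.c := by
      simpa using h
    -- Arrows `x : F h ⟶ z` and `y : F h' ⟶ z` with a common codomain give `x y⁻¹ : F h ⟶ F h'`,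
    -- which fullness lifts locally.
    obtain ⟨T', t, k, ht, hkd, hkc, hk⟩ := (isFull_iff_exists_cover F).1 hfull
      (x ≫ pullback.fst _ _) (y ≫ pullback.fst _ _)
      (G.mul (x ≫ pullback.snd _ _) ((y ≫ pullback.snd _ _) ≫ G.i) (by simp [h]))
      (by simp [pullback.condition]) (by simp [pullback.condition])
    rw [← cancel_epi t, ← Category.assoc, ← Category.assoc t]
    refine hK.transport_d_eq_of_arrow w (t ≫ x) (t ≫ y) k ?_ ?_ ?_ ?_
    · simp [h]
    · simp [hkd]
    · simp [hkc]
    · rw [hk, comp_mul]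
      exact G.mul_congr (by simp) (by simp)
  have hb₀ : l₀ ≫ K.f₀ = b.f₀ := by
    rw [← cancel_epi (pullback.snd F.f₀ G.d ≫ G.c), ← Category.assoc, hl₀, Category.assoc,
      ← map_d, ← Category.assoc, hK.transport_map w]
    simp [map_d]
  obtain ⟨l₁, hb₁, hc⟩ : ∃ l₁ : G.obj₁ ⟶ A.obj₁, l₁ ≫ K.f₁ = b.f₁ ∧ l₁ ≫ A.c = G.c ≫ l₀ :=
    ⟨IsPullback.lift hK b.f₁ (G.c ≫ l₀) (by rw [map_c, Category.assoc, hb₀]),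
      IsPullback.lift_fst hK _ _ _, IsPullback.lift_snd hK _ _ _⟩
  have hd : l₁ ≫ A.d = G.d ≫ l₀ := by
    -- Over a cover, the domain of the universal arrow of `G` is reached by some `x : F h ⟶ d`, and
    -- composing with that arrow reaches its codomain.
    obtain ⟨T, t, x, ht, hx⟩ := IsRegularEpi.exists_cover (pullback.snd F.f₀ G.d ≫ G.c) G.d
    rw [← cancel_epi t, ← Category.assoc, ← Category.assoc t, ← hx, Category.assoc x, hl₀]
    have hx' : (x ≫ pullback.snd _ _) ≫ G.c = t ≫ G.d := by simpa using hx
    refine hK.transport_postcomp w x (pullback.lift (x ≫ pullback.fst _ _)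
      (G.mul (x ≫ pullback.snd _ _) t hx') (by simp [pullback.condition])) t (t ≫ l₁) hx'
      (by simp) (by simp) (by simp [hb₁]) ?_
    rw [Category.assoc _ (hK.transport w), ← hl₀, Category.assoc, hc]
    simp only [← Category.assoc, pullback.lift_snd, mul_c]
  have ha₀ : F.f₀ ≫ l₀ = a.f₀ := by
    -- Evaluated at `1_{F h}`, whose transport is the identity of `a h`.
    have := commaUnit F ≫= hl₀
    rw [← Category.assoc (commaUnit F) (hK.transport w), hK.commaUnit_transport w] at this
    simpa [commaUnit] using this
  refine ⟨hK.liftHom b l₀ l₁ hb₀ hb₁ hd hc, ⟨Hom.ext ha₀ ?_, Hom.ext hb₀ hb₁⟩, ?_⟩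
  · change F.f₁ ≫ l₁ = a.f₁
    apply IsPullback.hom_ext hK
    · rw [Category.assoc, hb₁, f₁_w w]
    · rw [Category.assoc, hc, map_c_assoc, ha₀, map_c]
  · rintro l ⟨hl, hl'⟩
    have h₀ : l.f₀ = l₀ := by
      rw [← cancel_epi (pullback.snd F.f₀ G.d ≫ G.c), hl₀, hK.comp_filler_f₀ w hl hl']
    refine Hom.ext h₀ ?_
    change l.f₁ = l₁
    apply IsPullback.hom_ext hK
    · rw [hb₁, ← hl', comp_f₁]
    · rw [hc, map_c, h₀]

end Filler

end InternalGroupoid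

theorem theorem4p2 {C : Type u} [Category.{v} C] [BarrExact C] {H G : InternalGroupoid C}
    (F : H ⟶ G) :
    InternalGroupoid.IsFinal F ↔
      InternalGroupoid.IsFull F ∧ InternalGroupoid.IsEssSurj F :=
  ⟨fun hF ↦ ⟨hF.isFull, hF.isEssSurj⟩, fun h ↦
    InternalGroupoid.isFinal_of_isFull_of_isEssSurj h.1 h.2⟩
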